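/- Conventions. Let $(\overline M,\overline g)$ be a semi-Riemannian manifold (smooth metric of constant index) with Levi-Civita connection $\overline\nabla$, and let $(\overline\phi,\xi,\eta,\overline g)$ be an indefinite almost contact metric structure on it: $\overline\phi^2=-\mathbb I+\eta\otimes\xi$, $\eta(\xi)=1$, $\eta\circ\overline\phi=0$, $\overline\phi\xi=0$, $\overline g(\overline\phi X,\overline\phi Y)=\overline g(X,Y)-\eta(X)\eta(Y)$, $\eta=\overline g(\xi,\cdot)$. For a smooth function $\mu$ on $\overline M$ (for instance a constant), $\overline M$ is an indefinite nearly $\mu$-Sasakian manifold if $(\overline\nabla_X\overline\phi)Y+(\overline\nabla_Y\overline\phi)X=\mu\{2\overline g(X,Y)\xi-\eta(Y)X-\eta(X)Y\}$ for all vector fields $X,Y$. Let $M$ be an immersed $r$-lightlike submanifold, $r>0$: $\mathrm{Rad}\,TM=TM\cap TM^\perp$ is a smooth bundle of rank $r$. Choose a screen distribution $S(TM)$ (non-degenerate, $TM=\mathrm{Rad}\,TM\perp S(TM)$), a screen transversal bundle $S(TM^\perp)$ (non-degenerate, $TM^\perp=\mathrm{Rad}\,TM\perp S(TM^\perp)$),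 and a lightlike transversal bundle $l\mathrm{tr}(TM)$ (orthogonal to $S(TM)$ and $S(TM^\perp)$, locally spanned by smooth $N_1,\dots,N_r$ with $\overline g(E_i,N_j)=\delta_{ij}$, $\overline g(N_i,N_j)=0$ for a local frame $E_1,\dots,E_r$ of $\mathrm{Rad}\,TM$). Put $\mathrm{tr}(TM)=l\mathrm{tr}(TM)\perp S(TM^\perp)$, so that $T\overline M|_M=TM\oplus\mathrm{tr}(TM)$. The Gauss formula $\overline\nabla_XY=\nabla_XY+h(X,Y)$, with $\nabla_XY\in TM$ and $h(X,Y)\in\mathrm{tr}(TM)$, defines the induced connection $\nabla$ and the second fundamental form $h=h^l+h^s$, where $h^l$ and $h^s$ are the components in $l\mathrm{tr}(TM)$ and $S(TM^\perp)$. Let $g$ be the metric induced on $M$. $M$ is a proper quasi generalized CR (QGCR) lightlike submanifold if there are smooth vector bundles $D_1,D_2\subset\mathrm{Rad}\,TM$, $D_0,\overline D\subset S(TM)$, $\mathcal L\subset l\mathrm{tr}(TM)$, $\mathcal S\subset S(TM^\perp)$ with $D_1,D_2,D_0,\mathcal S$ non-zero, $D_0$ non-degenerate, such that $\mathrm{Rad}\,TM=D_1\oplus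 D_2$, $\overline\phi D_1=D_1$, $\overline\phi D_2\subset S(TM)$, $S(TM)=\{\overline\phi D_2+\overline D\}\perp D_0$, $\overline\phi D_0\subseteq D_0$, $\overline D=\overline\phi\mathcal S\oplus\overline\phi\mathcal L$ (the sum $\overline\phi D_2+\overline D$ need not be direct). $M$ is ascreen if $\xi$ takes values in $\mathrm{Rad}\,TM\oplus l\mathrm{tr}(TM)$ along $M$; irrotational if $\overline\nabla_XE\in\Gamma(TM)$ for all $X\in\Gamma(TM)$, $E\in\Gamma(\mathrm{Rad}\,TM)$; totally umbilical if there is $\mathcal H\in\Gamma(\mathrm{tr}(TM))$ with $h(X,Y)=g(X,Y)\mathcal H$ for all $X,Y\in\Gamma(TM)$, and then $\mathcal H^s$ denotes the $S(TM^\perp)$-component of $\mathcal H$. $\nabla$ is a metric connection if $\nabla g=0$. $M$ is minimal if $h^s=0$ on $\mathrm{Rad}\,TM$ (that is, $h^s(E,E')=0$ for $E,E'\in\mathrm{Rad}\,TM$) and the trace of $h$ with respect to $g|_{S(TM)}$ vanishes, that is, $\sum_i\epsilon_ih(X_i,X_i)=0$ for every orthonormal basis $(X_i)$ of $S(TM)$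 at any point, $\epsilon_i=g(X_i,X_i)=\pm1$. Statement. Let $M$ be a totally umbilical, irrotational, ascreen, proper QGCR-lightlike submanifold of an indefinite nearly $\mu$-Sasakian manifold $\overline M$ whose induced connection $\nabla$ is a metric connection. If $\mathcal H^s=0$, then $M$ is minimal. -/

import Mathlib

open scoped Manifold ContDiff Topology

noncomputable section

namespace Lightlike

section Ambient

variable (F : Type*) [NormedAddCommGroup F] [NormedSpace ℝ F]
  (N : Type*) [TopologicalSpace N] [ChartedSpace F N] [IsManifold 𝓘(ℝ, F) ∞ N]

/-- A semi-Riemannian metric on `N`: a smooth symmetric nondegenerate `(0,2)`-tensor field of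
constant index. -/
structure SemiRiemannianMetric where
  val (x : N) : TangentSpace 𝓘(ℝ, F) x →L[ℝ] TangentSpace 𝓘(ℝ, F) x →L[ℝ] ℝ
  symm (x : N) (v w : TangentSpace 𝓘(ℝ, F) x) : val x v w = val x w v
  nondegenerate (x : N) (v : TangentSpace 𝓘(ℝ, F) x) (hv : ∀ w, val x v w = 0) : v = 0
  contMDiff : ContMDiff 𝓘(ℝ, F) (𝓘(ℝ, F).prod 𝓘(ℝ, F →L[ℝ] F →L[ℝ] ℝ)) ∞
    (fun x ↦ Bundle.TotalSpace.mk' (F →L[ℝ] F →L[ℝ] ℝ)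
      (E := fun x : N ↦ TangentSpace 𝓘(ℝ, F) x →L[ℝ] TangentSpace 𝓘(ℝ, F) x →L[ℝ] ℝ) x (val x))
  index_const (x y : N) :
    sigNeg (LinearMap.BilinMap.toQuadraticMap (val x).toBilinForm) =
      sigNeg (LinearMap.BilinMap.toQuadraticMap (val y).toBilinForm)

variable {F N}

/-- A section of the tangent bundle which is smooth near `x`. -/
def SmoothFieldAt (X : ∀ x : N, TangentSpace 𝓘(ℝ, F) x) (x : N) : Prop :=
  ContMDiffAt 𝓘(ℝ, F) (𝓘(ℝ, F).prod 𝓘(ℝ, F)) ∞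
    (fun y ↦ (⟨y, X y⟩ : Bundle.TotalSpace F (TangentSpace 𝓘(ℝ, F) : N → Type _))) x

/-- `∇` is the Levi-Civita connection of `g`: it is torsion-free, and
`u (g(X, Y)) = g(∇_u X, Y) + g(X, ∇_u Y)`. Here `cov X x u` is `∇_u X` at `x`. -/
structure SemiRiemannianMetric.IsLeviCivita [FiniteDimensional ℝ F] (g : SemiRiemannianMetric F N)
    (cov : CovariantDerivative 𝓘(ℝ, F) F (TangentSpace 𝓘(ℝ, F) : N → Type _)) : Prop where
  torsion_eq_zero : cov.torsion = 0
  metric (x : N) (X Y : ∀ x : N, TangentSpace 𝓘(ℝ, F) x) (u : TangentSpace 𝓘(ℝ, F) x)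
    (hX : MDifferentiableAt 𝓘(ℝ, F) (𝓘(ℝ, F).prod 𝓘(ℝ, F))
      (fun y ↦ (⟨y, X y⟩ : Bundle.TotalSpace F (TangentSpace 𝓘(ℝ, F) : N → Type _))) x)
    (hY : MDifferentiableAt 𝓘(ℝ, F) (𝓘(ℝ, F).prod 𝓘(ℝ, F))
      (fun y ↦ (⟨y, Y y⟩ : Bundle.TotalSpace F (TangentSpace 𝓘(ℝ, F) : N → Type _))) x) :
    mvfderiv 𝓘(ℝ, F) (fun y ↦ g.val y (X y) (Y y)) x u =
      g.val x (cov X x u) (Y x) + g.val x (X x) (cov Y x u)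

/-- An indefinite almost contact metric structure `(φ, ξ, η, g)`. Smoothness of the 1-form `η`
is automatic from `η = g(ξ, ·)`. -/
structure AlmostContactMetricStructure (g : SemiRiemannianMetric F N) where
  φ (x : N) : TangentSpace 𝓘(ℝ, F) x →L[ℝ] TangentSpace 𝓘(ℝ, F) x
  ξ (x : N) : TangentSpace 𝓘(ℝ, F) x
  η (x : N) : TangentSpace 𝓘(ℝ, F) x →L[ℝ] ℝ
  φ_contMDiff : ContMDiff 𝓘(ℝ, F) (𝓘(ℝ, F).prod 𝓘(ℝ, F →L[ℝ] F)) ∞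
    (fun x ↦ Bundle.TotalSpace.mk' (F →L[ℝ] F)
      (E := fun x : N ↦ TangentSpace 𝓘(ℝ, F) x →L[ℝ] TangentSpace 𝓘(ℝ, F) x) x (φ x))
  ξ_smooth (x : N) : SmoothFieldAt ξ x
  φ_sq (x : N) (v : TangentSpace 𝓘(ℝ, F) x) : φ x (φ x v) = -v + η x v • ξ x
  η_ξ (x : N) : η x (ξ x) = 1
  η_φ (x : N) (v : TangentSpace 𝓘(ℝ, F) x) : η x (φ x v) = 0
  φ_ξ (x : N) : φ x (ξ x) = 0
  metric_φ (x : N) (v w : TangentSpace 𝓘(ℝ, F) x) :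
    g.val x (φ x v) (φ x w) = g.val x v w - η x v * η x w
  η_eq (x : N) (v : TangentSpace 𝓘(ℝ, F) x) : η x v = g.val x (ξ x) v

/-- `(∇_X φ) Y = ∇_X (φ Y) - φ (∇_X Y)` at `x`. -/
def AlmostContactMetricStructure.covφ {g : SemiRiemannianMetric F N}
    (A : AlmostContactMetricStructure g)
    (cov : CovariantDerivative 𝓘(ℝ, F) F (TangentSpace 𝓘(ℝ, F) : N → Type _))
    (X Y : ∀ x : N, TangentSpace 𝓘(ℝ, F) x) (x : N) : TangentSpace 𝓘(ℝ, F) x :=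
  cov (fun y ↦ A.φ y (Y y)) x (X x) - A.φ x (cov Y x (X x))

/-- The nearly `μ`-Sasakian condition
`(∇_X φ) Y + (∇_Y φ) X = μ {2 g(X, Y) ξ - η(Y) X - η(X) Y}`, with `∇` the Levi-Civita
connection. -/
def AlmostContactMetricStructure.IsNearlySasakian {g : SemiRiemannianMetric F N}
    (A : AlmostContactMetricStructure g)
    (cov : CovariantDerivative 𝓘(ℝ, F) F (TangentSpace 𝓘(ℝ, F) : N → Type _))
    (μ : N → ℝ) : Prop :=
  ∀ (x : N) (X Y : ∀ x : N, TangentSpace 𝓘(ℝ, F) x), SmoothFieldAt X x → SmoothFieldAt Y x →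
    A.covφ cov X Y x + A.covφ cov Y X x =
      μ x • ((2 * g.val x (X x) (Y x)) • A.ξ x - A.η x (Y x) • X x - A.η x (X x) • Y x)

end Ambient

section Along

variable (E : Type*) [NormedAddCommGroup E] [NormedSpace ℝ E]
  {F : Type*} [NormedAddCommGroup F] [NormedSpace ℝ F]
  {M : Type*} [TopologicalSpace M] [ChartedSpace E M] [IsManifold 𝓘(ℝ, E) ∞ M]
  {N : Type*} [TopologicalSpace N] [ChartedSpace F N] [IsManifold 𝓘(ℝ, F) ∞ N]

/-- A vector field along `f` which is smooth on `U`. -/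
def SmoothAlongOn (f : M → N) (V : ∀ p : M, TangentSpace 𝓘(ℝ, F) (f p)) (U : Set M) : Prop :=
  ContMDiffOn 𝓘(ℝ, E) (𝓘(ℝ, F).prod 𝓘(ℝ, F)) ∞
    (fun q ↦ (⟨f q, V q⟩ : Bundle.TotalSpace F (TangentSpace 𝓘(ℝ, F) : N → Type _))) U

/-- `D` is a smooth vector subbundle of rank `k` of the bundle `f^* TN` over `M`. -/
def IsSubbundle (f : M → N) (D : ∀ p : M, Submodule ℝ (TangentSpace 𝓘(ℝ, F) (f p))) (k : ℕ) :
    Prop :=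
  ∀ p : M, ∃ U ∈ 𝓝 p, ∃ s : Fin k → ∀ q : M, TangentSpace 𝓘(ℝ, F) (f q),
    (∀ i, SmoothAlongOn E f (s i) U) ∧
    ∀ q ∈ U, LinearIndependent ℝ (fun i ↦ s i q) ∧
      Submodule.span ℝ (Set.range fun i ↦ s i q) = D q

variable {E} in
/-- The vector field `df(Y)` along `f`, for `Y` a vector field on `M`. -/
def push (f : M → N) (Y : ∀ p : M, TangentSpace 𝓘(ℝ, E) p) (p : M) : TangentSpace 𝓘(ℝ, F) (f p) :=
  mfderiv 𝓘(ℝ, E) 𝓘(ℝ, F) f p (Y p)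

variable {E} in
/-- The covariant derivative at `p` of a vector field `V` along `f`, for the pulled back
connection `f^* ∇`: if `V = ∑ Vⁱ eᵢ` in the preferred local frame `eᵢ` of `TN` at `f p`, then
`∇_u V = ∑ (u Vⁱ) eᵢ + ∑ Vⁱ(p) ∇_{df u} eᵢ`. The second sum is `∇_{df u} C` where `C` is the
local field on `N` with constant components `Vⁱ(p)`. -/
def covAlong (cov : CovariantDerivative 𝓘(ℝ, F) F (TangentSpace 𝓘(ℝ, F) : N → Type _))
    (f : M → N) (V : ∀ p : M, TangentSpace 𝓘(ℝ, F) (f p)) (p : M)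
    (u : TangentSpace 𝓘(ℝ, E) p) : TangentSpace 𝓘(ℝ, F) (f p) :=
  let e := trivializationAt F (TangentSpace 𝓘(ℝ, F) : N → Type _) (f p)
  e.symm (f p) (mvfderiv 𝓘(ℝ, E) (fun q ↦ (e ⟨f q, V q⟩).2) p u) +
    cov (fun y ↦ e.symm y (e ⟨f p, V p⟩).2) (f p) (mfderiv 𝓘(ℝ, E) 𝓘(ℝ, F) f p u)

/-- The tangent space `T_p M` as a subspace of `T_{f p} N`. -/
def tangentSub (f : M → N) (p : M) : Submodule ℝ (TangentSpace 𝓘(ℝ, F) (f p)) :=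
  LinearMap.range (mfderiv 𝓘(ℝ, E) 𝓘(ℝ, F) f p).toLinearMap

/-- The orthogonal complement `T_p M^⊥`. -/
def normalSub (g : SemiRiemannianMetric F N) (f : M → N) (p : M) :
    Submodule ℝ (TangentSpace 𝓘(ℝ, F) (f p)) :=
  (g.val (f p)).toBilinForm.orthogonal (tangentSub E f p)

/-- The radical `Rad T_p M = T_p M ∩ T_p M^⊥`. -/
def radSub (g : SemiRiemannianMetric F N) (f : M → N) (p : M) :
    Submodule ℝ (TangentSpace 𝓘(ℝ, F) (f p)) :=
  tangentSub E f p ⊓ normalSub E g f p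

end Along

/-- An `r`-lightlike (immersed) submanifold `(M, g, S(TM), S(TM^⊥))` of `(N, g)`, `r > 0`, with a
lightlike transversal bundle `ltr(TM)`. The field `frames` says that, near each point, there are
smooth frames `E₁, …, E_r` of `Rad TM` and `N₁, …, N_r` of `ltr(TM)` with `g(Eᵢ, Nⱼ) = δᵢⱼ` and
`g(Nᵢ, Nⱼ) = 0`. -/
structure LightlikeSubmanifold {F : Type*} [NormedAddCommGroup F] [NormedSpace ℝ F]
    {N : Type*} [TopologicalSpace N] [ChartedSpace F N] [IsManifold 𝓘(ℝ, F) ∞ N]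
    (g : SemiRiemannianMetric F N)
    (E : Type*) [NormedAddCommGroup E] [NormedSpace ℝ E]
    (M : Type*) [TopologicalSpace M] [ChartedSpace E M] [IsManifold 𝓘(ℝ, E) ∞ M] where
  f : M → N
  contMDiff : ContMDiff 𝓘(ℝ, E) 𝓘(ℝ, F) ∞ f
  immersion (p : M) : Function.Injective (mfderiv 𝓘(ℝ, E) 𝓘(ℝ, F) f p)
  /-- The screen distribution `S(TM)`. -/
  scr (p : M) : Submodule ℝ (TangentSpace 𝓘(ℝ, F) (f p))
  /-- The screen transversal bundle `S(TM^⊥)`. -/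
  scrT (p : M) : Submodule ℝ (TangentSpace 𝓘(ℝ, F) (f p))
  /-- The lightlike transversal bundle `ltr(TM)`. -/
  ltr (p : M) : Submodule ℝ (TangentSpace 𝓘(ℝ, F) (f p))
  r : ℕ
  r_pos : 0 < r
  scr_subbundle : ∃ k, IsSubbundle E f scr k
  scr_nondegenerate (p : M) : ∀ v ∈ scr p, (∀ w ∈ scr p, g.val (f p) v w = 0) → v = 0
  scr_disjoint (p : M) : Disjoint (radSub E g f p) (scr p)
  scr_sup (p : M) : radSub E g f p ⊔ scr p = tangentSub E f p
  scrT_subbundle : ∃ k, IsSubbundle E f scrT k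
  scrT_nondegenerate (p : M) : ∀ v ∈ scrT p, (∀ w ∈ scrT p, g.val (f p) v w = 0) → v = 0
  scrT_disjoint (p : M) : Disjoint (radSub E g f p) (scrT p)
  scrT_sup (p : M) : radSub E g f p ⊔ scrT p = normalSub E g f p
  ltr_orth_scr (p : M) : ∀ v ∈ ltr p, ∀ w ∈ scr p, g.val (f p) v w = 0
  ltr_orth_scrT (p : M) : ∀ v ∈ ltr p, ∀ w ∈ scrT p, g.val (f p) v w = 0
  frames (p : M) : ∃ U ∈ 𝓝 p, ∃ e n : Fin r → ∀ q : M, TangentSpace 𝓘(ℝ, F) (f q),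
    (∀ i, SmoothAlongOn E f (e i) U) ∧ (∀ i, SmoothAlongOn E f (n i) U) ∧
    ∀ q ∈ U, Submodule.span ℝ (Set.range fun i ↦ e i q) = radSub E g f q ∧
      Submodule.span ℝ (Set.range fun i ↦ n i q) = ltr q ∧
      ∀ i j, g.val (f q) (e i q) (n j q) = (if i = j then 1 else 0) ∧
        g.val (f q) (n i q) (n j q) = 0

namespace LightlikeSubmanifold

variable {F : Type*} [NormedAddCommGroup F] [NormedSpace ℝ F]
  {N : Type*} [TopologicalSpace N] [ChartedSpace F N] [IsManifold 𝓘(ℝ, F) ∞ N]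
  {g : SemiRiemannianMetric F N}
  {E : Type*} [NormedAddCommGroup E] [NormedSpace ℝ E]
  {M : Type*} [TopologicalSpace M] [ChartedSpace E M] [IsManifold 𝓘(ℝ, E) ∞ M]
  (S : LightlikeSubmanifold g E M)

/-- `T_p M`. -/
abbrev tan (p : M) : Submodule ℝ (TangentSpace 𝓘(ℝ, F) (S.f p)) := tangentSub E S.f p

/-- `Rad T_p M`. -/
abbrev rad (p : M) : Submodule ℝ (TangentSpace 𝓘(ℝ, F) (S.f p)) := radSub E g S.f p

/-- The transversal bundle `tr(TM) = ltr(TM) ⊥ S(TM^⊥)`. -/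
def tr (p : M) : Submodule ℝ (TangentSpace 𝓘(ℝ, F) (S.f p)) := S.ltr p ⊔ S.scrT p

/-- Uniqueness of the decomposition `e + s + n + b` along `Rad ⊕ S(TM) ⊕ ltr ⊕ S(TM^⊥)`. -/
theorem eq_zero_of_sum (p : M) {e s n b : TangentSpace 𝓘(ℝ, F) (S.f p)}
    (he : e ∈ S.rad p) (hs : s ∈ S.scr p) (hn : n ∈ S.ltr p) (hb : b ∈ S.scrT p)
    (h : e + s + n + b = 0) : e = 0 ∧ s = 0 ∧ n = 0 ∧ b = 0 := by
  have symm := g.symm (S.f p)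
  have hst : ∀ v ∈ S.scr p, v ∈ S.tan p := fun v hv ↦ by
    rw [tan, ← S.scr_sup p]
    exact Submodule.mem_sup_right hv
  have hbn : ∀ v ∈ S.scrT p, v ∈ normalSub E g S.f p := fun v hv ↦ by
    have := S.scrT_sup p
    exact this ▸ Submodule.mem_sup_right hv
  have orth : ∀ v ∈ S.tan p, ∀ w ∈ normalSub E g S.f p, g.val (S.f p) v w = 0 :=
    fun v hv w hw ↦ hw v hv
  have hs0 : s = 0 := by
    refine S.scr_nondegenerate p s hs fun w hw ↦ ?_
    have h1 := congrArg (fun z ↦ g.val (S.f p) w z) h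
    simp only [map_add, map_zero] at h1
    rw [orth w (hst w hw) e he.2, orth w (hst w hw) b (hbn b hb), symm w n,
      S.ltr_orth_scr p n hn w hw] at h1
    rw [symm]; linarith
  have hb0 : b = 0 := by
    refine S.scrT_nondegenerate p b hb fun w hw ↦ ?_
    have h1 := congrArg (fun z ↦ g.val (S.f p) z w) h
    simp only [map_add, map_zero, add_apply, zero_apply] at h1
    rw [orth e he.1 w (hbn w hw), orth s (hst s hs) w (hbn w hw),
      S.ltr_orth_scrT p n hn w hw] at h1
    linarith
  subst hs0 hb0
  obtain ⟨U, hU, ef, nf, -, -, hfr⟩ := S.frames p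
  obtain ⟨h1, h2, h3⟩ := hfr p (mem_of_mem_nhds hU)
  have hn0 : n = 0 := by
    have hn' := hn
    rw [← h2, Submodule.mem_span_range_iff_exists_fun] at hn'
    obtain ⟨c, rfl⟩ := hn'
    have hc : ∀ i, c i = 0 := fun i ↦ by
      have hi : ef i p ∈ S.rad p := by
        rw [rad, ← h1]; exact Submodule.subset_span ⟨i, rfl⟩
      have h4 := congrArg (fun z ↦ g.val (S.f p) (ef i p) z) h
      simp only [map_add, map_zero, map_sum, map_smul, (h3 _ _).1] at h4
      rw [orth _ hi.1 e he.2] at h4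
      simpa using h4
    simp [hc]
  subst hn0
  refine ⟨by simpa using h, rfl, rfl, rfl⟩

variable [FiniteDimensional ℝ F]

/-- `Rad + S(TM) + ltr + S(TM^⊥) = T_{f p} N`. -/
theorem sup_eq_top (p : M) : S.tan p ⊔ S.tr p = ⊤ := by
  have : FiniteDimensional ℝ (TangentSpace 𝓘(ℝ, F) (S.f p)) :=
    inferInstanceAs (FiniteDimensional ℝ F)
  have symm := g.symm (S.f p)
  set B := (g.val (S.f p)).toBilinForm with hB
  have hBa : ∀ v w, B v w = g.val (S.f p) v w := fun _ _ ↦ rfl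
  have hrefl : B.IsRefl := fun v w h ↦ by rw [hBa] at *; rw [symm]; exact h
  have hnd : B.Nondegenerate := by
    refine ⟨fun v hv ↦ g.nondegenerate _ v hv, fun v hv ↦ g.nondegenerate _ v fun w ↦ ?_⟩
    rw [symm]; exact hv w
  rw [← LinearMap.BilinForm.orthogonal_orthogonal hnd hrefl (S.tan p ⊔ S.tr p)]
  have key : B.orthogonal (S.tan p ⊔ S.tr p) = ⊥ := by
    rw [eq_bot_iff]
    intro v hv
    have hv' : ∀ w ∈ S.tan p ⊔ S.tr p, g.val (S.f p) w v = 0 := fun w hw ↦ hv w hw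
    have hvn : v ∈ normalSub E g S.f p := fun w hw ↦ hv' w (Submodule.mem_sup_left hw)
    have hvn2 := hvn
    rw [← S.scrT_sup p] at hvn2
    obtain ⟨e, he, b, hb, rfl⟩ := Submodule.mem_sup.1 hvn2
    have hbn : ∀ w ∈ S.scrT p, w ∈ normalSub E g S.f p := fun w hw ↦ by
      have := S.scrT_sup p
      exact this ▸ Submodule.mem_sup_right hw
    have hb0 : b = 0 := by
      refine S.scrT_nondegenerate p b hb fun w hw ↦ ?_
      have h1 := hv' w (Submodule.mem_sup_right (Submodule.mem_sup_right hw))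
      rw [map_add, symm w e, show g.val (S.f p) e w = 0 from hbn w hw e he.1] at h1
      rw [symm]; linarith
    subst hb0
    obtain ⟨U, hU, ef, nf, -, -, hfr⟩ := S.frames p
    obtain ⟨h1, h2, h3⟩ := hfr p (mem_of_mem_nhds hU)
    have he' := he
    rw [← h1, Submodule.mem_span_range_iff_exists_fun] at he'
    obtain ⟨c, rfl⟩ := he'
    have hc : ∀ i, c i = 0 := fun i ↦ by
      have hi : nf i p ∈ S.ltr p := h2 ▸ Submodule.subset_span ⟨i, rfl⟩
      have h4 := hv' _ (Submodule.mem_sup_right (Submodule.mem_sup_left hi))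
      rw [symm] at h4
      simpa [(h3 _ _).1] using h4
    simp [hc]
  rw [key, LinearMap.BilinForm.orthogonal_bot]

/-- `T_{f p} N = T_p M ⊕ tr(TM)_p`. -/
theorem isCompl_tan_tr (p : M) : IsCompl (S.tan p) (S.tr p) := by
  refine ⟨?_, codisjoint_iff.2 (S.sup_eq_top p)⟩
  rw [Submodule.disjoint_def]
  intro v hv hv'
  have h := hv
  rw [tan, ← S.scr_sup p] at h
  obtain ⟨e, he, s, hs, rfl⟩ := Submodule.mem_sup.1 h
  obtain ⟨n, hn, b, hb, hnb⟩ := Submodule.mem_sup.1 hv'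
  obtain ⟨rfl, rfl, -, -⟩ := S.eq_zero_of_sum p he hs (neg_mem hn) (neg_mem hb)
    (by rw [add_assoc, ← hnb]; abel)
  simp

/-- `T_{f p} N = S(TM^⊥)_p ⊕ (T_p M ⊕ ltr(TM)_p)`. -/
theorem isCompl_scrT (p : M) : IsCompl (S.scrT p) (S.tan p ⊔ S.ltr p) := by
  refine ⟨?_, codisjoint_iff.2 ?_⟩
  · rw [Submodule.disjoint_def]
    intro b hb hb'
    rw [tan, ← S.scr_sup p] at hb'
    obtain ⟨t, ht, n, hn, h⟩ := Submodule.mem_sup.1 hb'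
    obtain ⟨e, he, s, hs, rfl⟩ := Submodule.mem_sup.1 ht
    obtain ⟨-, -, -, h0⟩ := S.eq_zero_of_sum p he hs hn (neg_mem hb) (by rw [h]; abel)
    simpa using h0
  · rw [← S.sup_eq_top p, tr, sup_comm, sup_assoc]

/-- The tangential component of a vector in `T_{f p} N = T_p M ⊕ tr(TM)_p`. -/
def tanPart (p : M) (w : TangentSpace 𝓘(ℝ, F) (S.f p)) : TangentSpace 𝓘(ℝ, F) (S.f p) :=
  Submodule.projection _ _ (S.isCompl_tan_tr p) w

/-- The transversal component of a vector in `T_{f p} N = T_p M ⊕ tr(TM)_p`. -/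
def trPart (p : M) (w : TangentSpace 𝓘(ℝ, F) (S.f p)) : TangentSpace 𝓘(ℝ, F) (S.f p) :=
  Submodule.projection _ _ (S.isCompl_tan_tr p).symm w

/-- The `S(TM^⊥)`-component of a vector in `T_{f p} N = T_p M ⊕ ltr(TM)_p ⊕ S(TM^⊥)_p`. -/
def scrTPart (p : M) (w : TangentSpace 𝓘(ℝ, F) (S.f p)) : TangentSpace 𝓘(ℝ, F) (S.f p) :=
  Submodule.projection _ _ (S.isCompl_scrT p) w

/-- The induced lightlike metric on `M`. -/
def gM (p : M) (u v : TangentSpace 𝓘(ℝ, E) p) : ℝ :=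
  g.val (S.f p) (mfderiv 𝓘(ℝ, E) 𝓘(ℝ, F) S.f p u) (mfderiv 𝓘(ℝ, E) 𝓘(ℝ, F) S.f p v)

variable (cov : CovariantDerivative 𝓘(ℝ, F) F (TangentSpace 𝓘(ℝ, F) : N → Type _))

/-- The induced connection: the image in `T_{f p} N` of the vector `∇_u Y` of `T_p M` given by the
Gauss formula `∇̄_u Y = ∇_u Y + h(u, Y)`. -/
def inducedConn (Y : ∀ p : M, TangentSpace 𝓘(ℝ, E) p) (p : M) (u : TangentSpace 𝓘(ℝ, E) p) :
    TangentSpace 𝓘(ℝ, F) (S.f p) :=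
  S.tanPart p (covAlong cov S.f (push S.f Y) p u)

/-- The second fundamental form `h(u, Y)` of the Gauss formula, with values in `tr(TM)`. -/
def sff (Y : ∀ p : M, TangentSpace 𝓘(ℝ, E) p) (p : M) (u : TangentSpace 𝓘(ℝ, E) p) :
    TangentSpace 𝓘(ℝ, F) (S.f p) :=
  S.trPart p (covAlong cov S.f (push S.f Y) p u)

/-- The screen second fundamental form `h^s(u, Y)`: the `S(TM^⊥)`-component of `h(u, Y)`. -/
def screenSff (Y : ∀ p : M, TangentSpace 𝓘(ℝ, E) p) (p : M) (u : TangentSpace 𝓘(ℝ, E) p) :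
    TangentSpace 𝓘(ℝ, F) (S.f p) :=
  S.scrTPart p (S.sff cov Y p u)

/-- The induced connection is a metric connection: `u (g(Y, Z)) = g(∇_u Y, Z) + g(Y, ∇_u Z)`. -/
def InducedConnIsMetric : Prop :=
  ∀ (p : M) (Y Z : ∀ p : M, TangentSpace 𝓘(ℝ, E) p) (u : TangentSpace 𝓘(ℝ, E) p),
    SmoothFieldAt Y p → SmoothFieldAt Z p →
    mvfderiv 𝓘(ℝ, E) (fun q ↦ S.gM q (Y q) (Z q)) p u =
      g.val (S.f p) (S.inducedConn cov Y p u) (push S.f Z p) +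
        g.val (S.f p) (push S.f Y p) (S.inducedConn cov Z p u)

/-- Irrotational: `∇̄_u Y` is tangent to `M` for every tangent vector `u` and every (local) section
`Y` of `Rad TM`. -/
def IsIrrotational : Prop :=
  ∀ (p : M) (Y : ∀ p : M, TangentSpace 𝓘(ℝ, E) p) (u : TangentSpace 𝓘(ℝ, E) p),
    SmoothFieldAt Y p → (∀ᶠ q in 𝓝 p, push S.f Y q ∈ S.rad q) →
    covAlong cov S.f (push S.f Y) p u ∈ S.tan p

/-- `H` is a smooth section of `tr(TM)` with `h(X, Y) = g(X, Y) H`. -/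
structure IsTransversalCurvatureField (H : ∀ p : M, TangentSpace 𝓘(ℝ, F) (S.f p)) : Prop where
  smooth : SmoothAlongOn E S.f H Set.univ
  mem_tr (p : M) : H p ∈ S.tr p
  sff_eq (p : M) (Y : ∀ p : M, TangentSpace 𝓘(ℝ, E) p) (u : TangentSpace 𝓘(ℝ, E) p)
    (hY : SmoothFieldAt Y p) : S.sff cov Y p u = S.gM p u (Y p) • H p

/-- `M` is minimal: `h^s = 0` on `Rad TM`, and the trace of `h` with respect to `g` restricted to
`S(TM)` vanishes, i.e. `∑ εᵢ h(Xᵢ, Xᵢ) = 0` at `p` whenever `X₁, …, X_k` are smooth vector fields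
whose values at `p` form an orthonormal basis of `S(TM)_p`, with `εᵢ = g(Xᵢ, Xᵢ) = ±1`. -/
structure IsMinimal : Prop where
  screenSff_rad (p : M) (Y : ∀ p : M, TangentSpace 𝓘(ℝ, E) p) (u : TangentSpace 𝓘(ℝ, E) p)
    (hY : SmoothFieldAt Y p) (hYrad : push S.f Y p ∈ S.rad p)
    (hu : mfderiv 𝓘(ℝ, E) 𝓘(ℝ, F) S.f p u ∈ S.rad p) : S.screenSff cov Y p u = 0
  trace_eq_zero (p : M) (k : ℕ) (X : Fin k → ∀ p : M, TangentSpace 𝓘(ℝ, E) p) (ε : Fin k → ℝ)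
    (hX : ∀ i, SmoothFieldAt (X i) p)
    (hspan : Submodule.span ℝ (Set.range fun i ↦ push S.f (X i) p) = S.scr p)
    (hε : ∀ i, ε i = 1 ∨ ε i = -1)
    (horth : ∀ i j, S.gM p (X i p) (X j p) = if i = j then ε i else 0) :
    ∑ i, ε i • S.sff cov (X i) p (X i p) = 0

variable (A : AlmostContactMetricStructure g)

/-- A proper quasi generalized CR (QGCR) lightlike submanifold, with ambient almost contact metric
structure `A`. Sums of bundles are direct where disjointness is recorded; the sum `φ D₂ + D̄` need
not be direct, as `φ L` and `φ D₂` may meet. -/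
structure IsProperQGCR : Prop where
  exists_bundles : ∃ (D₁ D₂ D₀ Dbar L T : ∀ p : M, Submodule ℝ (TangentSpace 𝓘(ℝ, F) (S.f p)))
    (k₁ k₂ k₀ kbar kL kT : ℕ),
    (IsSubbundle E S.f D₁ k₁ ∧ IsSubbundle E S.f D₂ k₂ ∧ IsSubbundle E S.f D₀ k₀ ∧
      IsSubbundle E S.f Dbar kbar ∧ IsSubbundle E S.f L kL ∧ IsSubbundle E S.f T kT) ∧
    (0 < k₁ ∧ 0 < k₂ ∧ 0 < k₀ ∧ 0 < kT) ∧
    ∀ p : M,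
      (Disjoint (D₁ p) (D₂ p) ∧ D₁ p ⊔ D₂ p = S.rad p) ∧
      (D₁ p).map (A.φ (S.f p)).toLinearMap = D₁ p ∧
      (D₂ p).map (A.φ (S.f p)).toLinearMap ≤ S.scr p ∧
      ((D₂ p).map (A.φ (S.f p)).toLinearMap ⊔ Dbar p) ⊔ D₀ p = S.scr p ∧
      (∀ v ∈ (D₂ p).map (A.φ (S.f p)).toLinearMap ⊔ Dbar p, ∀ w ∈ D₀ p,
        g.val (S.f p) v w = 0) ∧
      (∀ v ∈ D₀ p, (∀ w ∈ D₀ p, g.val (S.f p) v w = 0) → v = 0) ∧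
      (D₀ p).map (A.φ (S.f p)).toLinearMap ≤ D₀ p ∧
      L p ≤ S.ltr p ∧ T p ≤ S.scrT p ∧
      Disjoint ((T p).map (A.φ (S.f p)).toLinearMap) ((L p).map (A.φ (S.f p)).toLinearMap) ∧
      (T p).map (A.φ (S.f p)).toLinearMap ⊔ (L p).map (A.φ (S.f p)).toLinearMap = Dbar p

/-- Ascreen: the structure vector field `ξ` belongs to `Rad TM ⊕ ltr(TM)` along `M`. -/
def IsAscreen : Prop := ∀ p : M, A.ξ (S.f p) ∈ S.rad p ⊔ S.ltr p

end LightlikeSubmanifold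

end Lightlike

end

/-! The submanifold is in fact totally geodesic. Both the Levi-Civita connection, pulled back to
`M`, and the induced connection differentiate `g(Y, Z)` by the Leibniz rule; comparing the two rules
leaves `g(h(u, Y), Z) + g(Y, h(u, Z)) = 0` (`sff_skew`). Take `Z` radical at the point: `h(u, Z) =
g(u, Z) H` vanishes there, so umbilicity gives `g(u, Y) g(H, Z) = 0`. The QGCR structure provides
screen vectors with `g(u, Y) ≠ 0`, because `D₀` is non-zero and non-degenerate; hence `H` is
orthogonal to `Rad TM` (`IsTransversalCurvatureField.orthogonal_rad`). If `H^s = 0`, then `H` lies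
in `ltr(TM)`, which `g` pairs perfectly with `Rad TM`, so `H = 0`. Then `h = 0`, and both conditions
of minimality hold. -/

namespace Lightlike

/-! ### Product rule on manifolds -/

section

variable {E : Type*} [NormedAddCommGroup E] [NormedSpace ℝ E]
  {M : Type*} [TopologicalSpace M] [ChartedSpace E M]
  {F₁ F₂ : Type*} [NormedAddCommGroup F₁] [NormedSpace ℝ F₁]
  [NormedAddCommGroup F₂] [NormedSpace ℝ F₂]

/-- Product rule for the evaluation of a family of continuous linear maps. -/
theorem mvfderiv_clm_apply {c : M → F₁ →L[ℝ] F₂} {v : M → F₁} {p : M}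
    (hc : MDifferentiableAt 𝓘(ℝ, E) 𝓘(ℝ, F₁ →L[ℝ] F₂) c p)
    (hv : MDifferentiableAt 𝓘(ℝ, E) 𝓘(ℝ, F₁) v p) (u : TangentSpace 𝓘(ℝ, E) p) :
    mvfderiv 𝓘(ℝ, E) (fun q ↦ c q (v q)) p u =
      mvfderiv 𝓘(ℝ, E) c p u (v p) + c p (mvfderiv 𝓘(ℝ, E) v p u) := by
  have h1 := hc.hasMFDerivAt
  have h2 := hv.hasMFDerivAt
  -- The derivatives are retyped over the model spaces, so that composition and `flip` make sense.
  let c' : E →L[ℝ] F₁ →L[ℝ] F₂ := mvfderiv 𝓘(ℝ, E) c p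
  let v' : E →L[ℝ] F₁ := mvfderiv 𝓘(ℝ, E) v p
  have h3 : HasMFDerivAt 𝓘(ℝ, E) 𝓘(ℝ, F₂) (fun q ↦ c q (v q)) p
      ((c p).comp v' + c'.flip (v p)) := by
    refine ⟨h1.1.clm_apply h2.1, ?_⟩
    have h := h1.2.clm_apply h2.2
    simp only [writtenInExtChartAt, Function.comp_apply, extChartAt_to_inv] at h
    exact h
  refine (DFunLike.congr_fun h3.mfderiv u).trans ?_
  rw [add_comm]
  rfl

end

/-! ### Metric compatibility of the pulled back connection -/

section

variable {F : Type*} [NormedAddCommGroup F] [NormedSpace ℝ F]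
  {N : Type*} [TopologicalSpace N] [ChartedSpace F N] [IsManifold 𝓘(ℝ, F) ∞ N]

/-- The matrix of a semi-Riemannian metric in the preferred local frame at `x`, as a smooth
function with values in bilinear forms on the model space. -/
theorem SemiRiemannianMetric.exists_local_form (g : SemiRiemannianMetric F N) (x : N) :
    ∃ G : N → F →L[ℝ] F →L[ℝ] ℝ, MDifferentiableAt 𝓘(ℝ, F) 𝓘(ℝ, F →L[ℝ] F →L[ℝ] ℝ) G x ∧
      ∀ᶠ y in 𝓝 x, ∀ a b : F, G y a b =
        g.val y ((trivializationAt F (TangentSpace 𝓘(ℝ, F) : N → Type _) x).symm y a)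
          ((trivializationAt F (TangentSpace 𝓘(ℝ, F) : N → Type _) x).symm y b) := by
  have h := g.contMDiff x
  rw [Bundle.contMDiffAt_section] at h
  -- The witness is the coordinate expression of the section `g` in the trivialization of the bundle
  -- of bilinear forms at `x`.
  refine ⟨_, h.mdifferentiableAt (by simp), ?_⟩
  have hb : (trivializationAt F (TangentSpace 𝓘(ℝ, F) : N → Type _) x).baseSet ∈ 𝓝 x :=
    (trivializationAt F (TangentSpace 𝓘(ℝ, F) : N → Type _) x).open_baseSet.mem_nhds
      (FiberBundle.mem_baseSet_trivializationAt' x)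
  filter_upwards [hb] with y hy a b
  simp [hom_trivializationAt_apply, ContinuousLinearMap.inCoordinates]
  rw [Bundle.Trivialization.linearMapAt_apply, if_pos]
  · simp [hom_trivializationAt_apply, ContinuousLinearMap.inCoordinates]
    rw [Bundle.Trivialization.symmL_apply _ hy, Bundle.Trivialization.symmL_apply _ hy]
  · simpa [hom_trivializationAt_baseSet] using hy

/-- The pulled back Levi-Civita connection is compatible with the metric. -/
theorem SemiRiemannianMetric.IsLeviCivita.mvfderiv_along [FiniteDimensional ℝ F]
    {E : Type*} [NormedAddCommGroup E] [NormedSpace ℝ E]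
    {M : Type*} [TopologicalSpace M] [ChartedSpace E M]
    {g : SemiRiemannianMetric F N}
    {cov : CovariantDerivative 𝓘(ℝ, F) F (TangentSpace 𝓘(ℝ, F) : N → Type _)}
    (hcov : g.IsLeviCivita cov) {f : M → N} {p : M}
    (hf : MDifferentiableAt 𝓘(ℝ, E) 𝓘(ℝ, F) f p)
    {V W : ∀ q : M, TangentSpace 𝓘(ℝ, F) (f q)}
    (hV : MDifferentiableAt 𝓘(ℝ, E) (𝓘(ℝ, F).prod 𝓘(ℝ, F))
      (fun q ↦ (⟨f q, V q⟩ : Bundle.TotalSpace F (TangentSpace 𝓘(ℝ, F) : N → Type _))) p)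
    (hW : MDifferentiableAt 𝓘(ℝ, E) (𝓘(ℝ, F).prod 𝓘(ℝ, F))
      (fun q ↦ (⟨f q, W q⟩ : Bundle.TotalSpace F (TangentSpace 𝓘(ℝ, F) : N → Type _))) p)
    (u : TangentSpace 𝓘(ℝ, E) p) :
    mvfderiv 𝓘(ℝ, E) (fun q ↦ g.val (f q) (V q) (W q)) p u =
      g.val (f p) (covAlong cov f V p u) (W p) + g.val (f p) (V p) (covAlong cov f W p u) := by
  -- In the frame at `f p`, `g(V, W) = G(v, w)`, and the product rule gives three terms. Those
  -- differentiating `v` and `w` match the first summands of `covAlong`. The one differentiating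
  -- `G`, with `v` and `w` frozen at `p`, is treated by metric compatibility on `N` for fields with
  -- constant components, and gives the second summands.
  obtain ⟨G, hG, hGe⟩ := g.exists_local_form (f p)
  have hv := (mdifferentiableAt_totalSpace _ _).1 hV |>.2
  have hw := (mdifferentiableAt_totalSpace _ _).1 hW |>.2
  simp only at hv hw
  let e := trivializationAt F (TangentSpace 𝓘(ℝ, F) : N → Type _) (f p)
  have hp : f p ∈ e.baseSet := FiberBundle.mem_baseSet_trivializationAt' _
  let v : M → F := fun q ↦ (e ⟨f q, V q⟩).2
  let w : M → F := fun q ↦ (e ⟨f q, W q⟩).2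
  have hsymm : ∀ U : ∀ q : M, TangentSpace 𝓘(ℝ, F) (f q), ∀ q, f q ∈ e.baseSet →
      e.symm (f q) (e ⟨f q, U q⟩).2 = U q := fun U q hq ↦ by
    simp [hq]
  have hGp : ∀ a b, G (f p) a b = g.val (f p) (e.symm (f p) a) (e.symm (f p) b) :=
    hGe.self_of_nhds
  have hev : (fun q ↦ g.val (f q) (V q) (W q)) =ᶠ[𝓝 p] fun q ↦ G (f q) (v q) (w q) := by
    filter_upwards [hf.continuousAt.eventually hGe,
      hf.continuousAt.eventually (e.open_baseSet.mem_nhds hp)] with q hq hqb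
    rw [hq, hsymm V q hqb, hsymm W q hqb]
  have hGf : MDifferentiableAt 𝓘(ℝ, E) 𝓘(ℝ, F →L[ℝ] F →L[ℝ] ℝ) (fun q ↦ G (f q)) p :=
    hG.comp p hf
  have h1 : mvfderiv 𝓘(ℝ, E) (fun q ↦ g.val (f q) (V q) (W q)) p u =
      mvfderiv 𝓘(ℝ, E) (fun q ↦ G (f q) (v q) (w q)) p u :=
    DFunLike.congr_fun hev.mfderiv_eq u
  have h2 : mvfderiv 𝓘(ℝ, E) (fun q ↦ G (f q)) p u =
      mvfderiv 𝓘(ℝ, F) G (f p) (mfderiv 𝓘(ℝ, E) 𝓘(ℝ, F) f p u) :=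
    mfderiv_comp_apply p hG hf u
  have hC : ∀ U : ∀ q : M, TangentSpace 𝓘(ℝ, F) (f q),
      MDifferentiableAt 𝓘(ℝ, F) (𝓘(ℝ, F).prod 𝓘(ℝ, F))
      (fun y ↦ (⟨y, e.symm y (e ⟨f p, U p⟩).2⟩ :
        Bundle.TotalSpace F (TangentSpace 𝓘(ℝ, F) : N → Type _))) (f p) := fun U ↦
    -- The field with constant components is by definition `FiberBundle.extend` of `U p`.
    FiberBundle.mdifferentiableAt_extend 𝓘(ℝ, F) F (U p)
  have h3 := hcov.metric (f p) _ _ (mfderiv 𝓘(ℝ, E) 𝓘(ℝ, F) f p u) (hC V) (hC W)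
  have hev' : (fun y ↦ g.val y (e.symm y (v p)) (e.symm y (w p))) =ᶠ[𝓝 (f p)]
      fun y ↦ G y (v p) (w p) := by
    filter_upwards [hGe] with y hy
    rw [hy]
  have h4 : mvfderiv 𝓘(ℝ, F) (fun y ↦ g.val y (e.symm y (v p)) (e.symm y (w p))) (f p)
      (mfderiv 𝓘(ℝ, E) 𝓘(ℝ, F) f p u) = mvfderiv 𝓘(ℝ, F) (fun y ↦ G y (v p) (w p)) (f p)
      (mfderiv 𝓘(ℝ, E) 𝓘(ℝ, F) f p u) :=
    DFunLike.congr_fun hev'.mfderiv_eq _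
  have h5 : mvfderiv 𝓘(ℝ, F) (fun y ↦ G y (v p) (w p)) (f p)
      (mfderiv 𝓘(ℝ, E) 𝓘(ℝ, F) f p u) =
      mvfderiv 𝓘(ℝ, F) G (f p) (mfderiv 𝓘(ℝ, E) 𝓘(ℝ, F) f p u) (v p) (w p) := by
    rw [mvfderiv_clm_apply (hG.clm_apply mdifferentiableAt_const) mdifferentiableAt_const,
      mvfderiv_clm_apply hG mdifferentiableAt_const]
    simp [mvfderiv_const]
  have h3' := (h4.trans h5).symm.trans h3
  rw [hsymm V p hp, hsymm W p hp] at h3'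
  rw [h1, mvfderiv_clm_apply (hGf.clm_apply hv) hw, mvfderiv_clm_apply hGf hv, add_apply, h2, h3',
    hGp, hGp, hsymm V p hp, hsymm W p hp]
  simp only [covAlong, map_add, add_apply]
  change _ = (g.val (f p) (e.symm (f p) (mvfderiv 𝓘(ℝ, E) v p u)) (W p) + _) +
    (g.val (f p) (V p) (e.symm (f p) (mvfderiv 𝓘(ℝ, E) w p u)) + _)
  abel

end

/-! ### Pointwise algebra of the splitting, and extension of vectors to fields -/

namespace LightlikeSubmanifold

variable {F : Type*} [NormedAddCommGroup F] [NormedSpace ℝ F]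
  {N : Type*} [TopologicalSpace N] [ChartedSpace F N] [IsManifold 𝓘(ℝ, F) ∞ N]
  {g : SemiRiemannianMetric F N}
  {E : Type*} [NormedAddCommGroup E] [NormedSpace ℝ E]
  {M : Type*} [TopologicalSpace M] [ChartedSpace E M] [IsManifold 𝓘(ℝ, E) ∞ M]
  (S : LightlikeSubmanifold g E M)

/-- Turns `H^s = 0` into `H ∈ ltr(TM)`: the `S(TM^⊥)`-summand of `w` also lies in the complement `TM
⊕ ltr(TM)`, hence is zero. -/
theorem mem_ltr_of_scrTPart_eq_zero [FiniteDimensional ℝ F] {p : M}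
    {w : TangentSpace 𝓘(ℝ, F) (S.f p)} (hw : w ∈ S.tr p) (h : S.scrTPart p w = 0) :
    w ∈ S.ltr p := by
  obtain ⟨n, hn, b, hb, rfl⟩ := Submodule.mem_sup.1 hw
  have h1 := (Submodule.projection_apply_eq_zero_iff (S.isCompl_scrT p)).1 h
  have h2 : b ∈ S.tan p ⊔ S.ltr p := by
    have := sub_mem h1 (Submodule.mem_sup_right hn : n ∈ S.tan p ⊔ S.ltr p)
    simpa using this
  rw [Submodule.disjoint_def.1 (S.isCompl_scrT p).disjoint b hb h2, add_zero]
  exact hn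

/-- A lightlike transversal vector orthogonal to the radical vanishes. -/
theorem eq_zero_of_mem_ltr {p : M} {w : TangentSpace 𝓘(ℝ, F) (S.f p)} (hw : w ∈ S.ltr p)
    (h : ∀ e ∈ S.rad p, g.val (S.f p) w e = 0) : w = 0 := by
  obtain ⟨U, hU, e, n, -, -, hfr⟩ := S.frames p
  obtain ⟨h1, h2, h3⟩ := hfr p (mem_of_mem_nhds hU)
  rw [← h2, Submodule.mem_span_range_iff_exists_fun] at hw
  obtain ⟨c, rfl⟩ := hw
  -- Pairing with the dual frame vector `e i` isolates the coefficient `c i`.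
  have hc : ∀ i, c i = 0 := fun i ↦ by
    have h4 := h (e i p) (by rw [rad, ← h1]; exact Submodule.subset_span ⟨i, rfl⟩)
    rw [g.symm] at h4
    simpa [(h3 _ _).1] using h4
  simp [hc]

/-- The screen distribution of a proper QGCR lightlike submanifold has a non-isotropic pair. -/
theorem IsProperQGCR.exists_scr_ne_zero {S : LightlikeSubmanifold g E M}
    {A : AlmostContactMetricStructure g} (h : S.IsProperQGCR A) (p : M) :
    ∃ v ∈ S.scr p, ∃ w ∈ S.scr p, g.val (S.f p) v w ≠ 0 := by
  obtain ⟨D₁, D₂, D₀, Dbar, L, T, k₁, k₂, k₀, kbar, kL, kT, ⟨-, -, hD₀, -⟩, ⟨-, -, hk₀, -⟩, hp⟩ :=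
    h.exists_bundles
  obtain ⟨-, -, -, hscr, -, hnd, -⟩ := hp p
  obtain ⟨U, hU, s, -, hs⟩ := hD₀ p
  obtain ⟨hli, hspan⟩ := hs p (mem_of_mem_nhds hU)
  have hv : s ⟨0, hk₀⟩ p ∈ D₀ p := hspan ▸ Submodule.subset_span ⟨_, rfl⟩
  have hle : D₀ p ≤ S.scr p := hscr ▸ le_sup_right
  by_contra! hcon
  -- If `g` vanished on the screen, non-degeneracy of `D₀` would kill a vector of its frame.
  exact hli.ne_zero ⟨0, hk₀⟩ (hnd _ hv fun w hw ↦ hcon _ (hle hv) w (hle hw))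

/-- A vector field on `M` which is smooth at `p` gives a smooth vector field along the immersion. -/
theorem mdifferentiableAt_push {Y : ∀ p : M, TangentSpace 𝓘(ℝ, E) p} {p : M}
    (hY : SmoothFieldAt Y p) :
    MDifferentiableAt 𝓘(ℝ, E) (𝓘(ℝ, F).prod 𝓘(ℝ, F))
      (fun q ↦ (⟨S.f q, push S.f Y q⟩ :
        Bundle.TotalSpace F (TangentSpace 𝓘(ℝ, F) : N → Type _))) p := by
  -- `push S.f Y` is the tangent map of `S.f` composed with the section `Y`.
  have h := (S.contMDiff.contMDiff_tangentMap (m := 1) (by norm_cast)).contMDiffAt.mdifferentiableAt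
    (x := (⟨p, Y p⟩ : TangentBundle 𝓘(ℝ, E) M)) (by simp)
  exact MDifferentiableAt.comp p h (ContMDiffAt.mdifferentiableAt hY (by simp))

/-- The second fundamental form takes a field as argument, so a pointwise statement about `H` needs
each tangent vector as the value of a smooth field. -/
theorem exists_smooth_push_eq {p : M} {v : TangentSpace 𝓘(ℝ, F) (S.f p)} (hv : v ∈ S.tan p) :
    ∃ Y : ∀ p : M, TangentSpace 𝓘(ℝ, E) p, SmoothFieldAt Y p ∧ push S.f Y p = v := by
  obtain ⟨u, rfl⟩ := hv
  refine ⟨FiberBundle.extend E u, FiberBundle.contMDiffAt_extend 𝓘(ℝ, E) E u, ?_⟩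
  simp [push]

/-! ### Second fundamental form, umbilicity and minimality -/

variable [FiniteDimensional ℝ F]
  {cov : CovariantDerivative 𝓘(ℝ, F) F (TangentSpace 𝓘(ℝ, F) : N → Type _)}

/-- For a metric induced connection, the second fundamental form is skew with respect to the
ambient metric. -/
theorem sff_skew {S : LightlikeSubmanifold g E M} (hcov : g.IsLeviCivita cov)
    (hmetric : S.InducedConnIsMetric cov)
    {p : M} {Y Z : ∀ p : M, TangentSpace 𝓘(ℝ, E) p} (hY : SmoothFieldAt Y p)
    (hZ : SmoothFieldAt Z p) (u : TangentSpace 𝓘(ℝ, E) p) :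
    g.val (S.f p) (S.sff cov Y p u) (push S.f Z p) +
      g.val (S.f p) (push S.f Y p) (S.sff cov Z p u) = 0 := by
  have h1 := hmetric p Y Z u hY hZ
  have h2 := hcov.mvfderiv_along (S.contMDiff.mdifferentiableAt (x := p) (by simp))
    (S.mdifferentiableAt_push hY) (S.mdifferentiableAt_push hZ) u
  have hdec : ∀ Y, covAlong cov S.f (push S.f Y) p u =
      S.inducedConn cov Y p u + S.sff cov Y p u := fun Y ↦
    (Submodule.projection_add_projection_eq_self (S.isCompl_tan_tr p) _).symm
  rw [hdec, hdec] at h2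
  simp only [map_add, add_apply] at h2
  -- Both sides compute `u (g(Y, Z))`, as `gM` unfolds to `g` on pushed fields; the tangential terms
  -- cancel and the transversal ones remain.
  have h3 := h1.symm.trans h2
  linarith

/-- For a metric induced connection, the transversal curvature vector field of a totally umbilical
submanifold is orthogonal to the radical wherever the screen distribution is non-zero. -/
theorem IsTransversalCurvatureField.orthogonal_rad {S : LightlikeSubmanifold g E M}
    {H : ∀ p : M, TangentSpace 𝓘(ℝ, F) (S.f p)} (hH : S.IsTransversalCurvatureField cov H)
    (hcov : g.IsLeviCivita cov) (hmetric : S.InducedConnIsMetric cov) {p : M}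
    (hscr : ∃ v ∈ S.scr p, ∃ w ∈ S.scr p, g.val (S.f p) v w ≠ 0)
    {e : TangentSpace 𝓘(ℝ, F) (S.f p)} (he : e ∈ S.rad p) : g.val (S.f p) (H p) e = 0 := by
  obtain ⟨v, hv, w, hw, hvw⟩ := hscr
  have hle : S.scr p ≤ S.tan p := le_sup_right.trans (S.scr_sup p).le
  obtain ⟨u, rfl⟩ := hle hv
  obtain ⟨Y, hY, rfl⟩ := S.exists_smooth_push_eq (hle hw)
  obtain ⟨Z, hZ, rfl⟩ := S.exists_smooth_push_eq he.1
  have h := sff_skew hcov hmetric hY hZ u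
  -- `Z` is radical only at `p`; this is enough, since umbilicity makes `h(u, Z)` depend on `Z p`
  -- alone.
  have h0 : S.gM p u (Z p) = 0 := he.2 _ (hle hv)
  rw [hH.sff_eq p Y u hY, hH.sff_eq p Z u hZ, h0, zero_smul, map_zero, add_zero, map_smul] at h
  exact (mul_eq_zero.1 h).resolve_left hvw

/-- A totally umbilical submanifold with vanishing transversal curvature vector field is
minimal. -/
theorem IsTransversalCurvatureField.isMinimal {S : LightlikeSubmanifold g E M}
    {H : ∀ p : M, TangentSpace 𝓘(ℝ, F) (S.f p)} (hH : S.IsTransversalCurvatureField cov H)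
    (h : ∀ p, H p = 0) : S.IsMinimal cov where
  screenSff_rad p Y u hY _ _ := by
    simp [screenSff, scrTPart, hH.sff_eq p Y u hY, h]
  trace_eq_zero p k X ε hX _ _ _ := by
    simp [hH.sff_eq p _ _ (hX _), h]

end LightlikeSubmanifold

end Lightlike

theorem mainTheorem2
    {F : Type*} [NormedAddCommGroup F] [NormedSpace ℝ F] [FiniteDimensional ℝ F]
    {N : Type*} [TopologicalSpace N] [T2Space N] [SecondCountableTopology N]
    [ChartedSpace F N] [IsManifold 𝓘(ℝ, F) ∞ N]
    {E : Type*} [NormedAddCommGroup E] [NormedSpace ℝ E] [FiniteDimensional ℝ E]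
    {M : Type*} [TopologicalSpace M] [T2Space M] [SecondCountableTopology M]
    [ChartedSpace E M] [IsManifold 𝓘(ℝ, E) ∞ M]
    (g : Lightlike.SemiRiemannianMetric F N)
    (cov : CovariantDerivative 𝓘(ℝ, F) F
      (TangentSpace 𝓘(ℝ, F) : N → Type _))
    (hcov : g.IsLeviCivita cov)
    (A : Lightlike.AlmostContactMetricStructure g)
    (μ : N → ℝ) (hμ : ContMDiff 𝓘(ℝ, F) 𝓘(ℝ, ℝ) ∞ μ)
    (hA : A.IsNearlySasakian cov μ)
    (S : Lightlike.LightlikeSubmanifold g E M)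
    (hQGCR : S.IsProperQGCR A)
    (hascreen : S.IsAscreen A)
    (hirrotational : S.IsIrrotational cov)
    (hmetric : S.InducedConnIsMetric cov)
    (H : ∀ p : M, TangentSpace 𝓘(ℝ, F) (S.f p))
    (humbilical : S.IsTransversalCurvatureField cov H)
    (hHs : ∀ p : M, S.scrTPart p (H p) = 0) :
    S.IsMinimal cov := by
  exact humbilical.isMinimal fun p ↦
    S.eq_zero_of_mem_ltr (S.mem_ltr_of_scrTPart_eq_zero (humbilical.mem_tr p) (hHs p))
      fun _ he ↦ humbilical.orthogonal_rad hcov hmetric (hQGCR.exists_scr_ne_zero p) he
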